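/- Let $(M,I)$ be a complex manifold, let $\omega$ be a (possibly indefinite) Kähler form on $M$, i.e. a smooth closed nondegenerate real 2-form with $\omega(IX,IY)=\omega(X,Y)$, and let $\nabla$ be a linear connection on the real tangent bundle $TM$ such that $(M,I,\nabla,\omega)$ is a special Kähler manifold: $\nabla$ is flat and torsion free, $d_\nabla I=0$ (where $I$ is regarded as a $TM$-valued one-form), and $\nabla\omega=0$. Let $D$ be the Levi-Civita connection of the (pseudo-)Riemannian metric $g(X,Y)=\omega(X,IY)$. Let $T^{\mathbb C}M=TM\otimes_{\mathbb R}\mathbb C=T^{1,0}\oplus T^{0,1}$ be the decomposition into the $\pm\sqrt{-1}$-eigenbundles of $I$. Extend $\nabla-D$ complex linearly to a one-form with values in $\mathrm{End}(T^{\mathbb C}M)$ and write $$\nabla-D=A+\overline A,$$ where $A$ is its $(1,0)$-part and $\overline A$ its $(0,1)$-part as a one-form; then $\overline A$ is the complex conjugate of $A$, i.e. $\overline A_{\bar\xi}(\bar\eta)=\overline{A_\xi(\eta)}$. Moreover $$A\in\Omega^{1,0}(\mathrm{Hom}(T^{1,0},T^{0,1})),\qquad \overline A\in\Omega^{0,1}(\mathrm{Hom}(T^{0,1},T^{1,0})).$$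 That is, $A$ and $\overline A$ are smooth, $A$ is zero on directions in $T^{0,1}$, and its values vanish on $T^{0,1}$ and map $T^{1,0}$ to $T^{0,1}$; and $\overline A$ is zero on directions in $T^{1,0}$, and its values vanish on $T^{1,0}$ and map $T^{0,1}$ to $T^{1,0}$. -/

import Mathlib

open scoped Manifold ContDiff TensorProduct

noncomputable section

namespace SpecialKahler

/-! Complex manifolds are Mathlib's: `M` is charted on the finite-dimensional complex vector space
`E` with holomorphic transition maps. The underlying real smooth manifold has the same charts. -/

/-- A complex manifold is a smooth real manifold. -/
instance isManifoldReal {E : Type*} [NormedAddCommGroup E] [NormedSpace ℂ E]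
    {M : Type*} [TopologicalSpace M] [ChartedSpace E M] [IsManifold 𝓘(ℂ, E) ω M] :
    IsManifold 𝓘(ℝ, E) ∞ M := by
  refine isManifold_of_contDiffOn 𝓘(ℝ, E) ∞ M fun e e' he he' => ?_
  have h : ContDiffOn ℂ ω (e.symm.trans e') (e.symm.trans e').source := by
    have h1 := (contDiffGroupoid ω 𝓘(ℂ, E)).compatible he he'
    have h2 := (contMDiffOn_of_mem_contDiffGroupoid h1)
    exact contMDiffOn_iff_contDiffOn.1 h2
  have h' := (h.restrict_scalars ℝ).of_le (m := ∞) le_top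
  simpa using h'

/-- The real tangent space of the complex manifold `M` at `x`. -/
abbrev RealTangent (E : Type*) [NormedAddCommGroup E] [NormedSpace ℂ E]
    {M : Type*} [TopologicalSpace M] [ChartedSpace E M] (x : M) : Type _ :=
  TangentSpace 𝓘(ℝ, E) x

/-- Linear connections on the real tangent bundle of `M` (as covariant derivatives);
`nabla Y x v` is the derivative of `Y` in the direction `v` at `x`. -/
abbrev Connection (E : Type*) [NormedAddCommGroup E] [NormedSpace ℂ E]
    (M : Type*) [TopologicalSpace M] [ChartedSpace E M] [IsManifold 𝓘(ℂ, E) ω M] :=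
  CovariantDerivative 𝓘(ℝ, E) E (TangentSpace 𝓘(ℝ, E) : M → Type _)

/-- The complex structure `I` of the complex manifold `M` on its real tangent bundle.
The tangent space at `x` is identified by Mathlib with the model space `E` through
the preferred holomorphic chart at `x`, and `I` is multiplication by the imaginary unit there. -/
def cplx (E : Type*) [NormedAddCommGroup E] [NormedSpace ℂ E]
    {M : Type*} [TopologicalSpace M] [ChartedSpace E M] (x : M) :
    RealTangent E x →L[ℝ] RealTangent E x :=
  (Complex.I • ContinuousLinearMap.id ℝ E : E →L[ℝ] E)

section Real

variable {E : Type*} [NormedAddCommGroup E] [NormedSpace ℂ E] [FiniteDimensional ℂ E]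
  {M : Type*} [TopologicalSpace M] [ChartedSpace E M] [IsManifold 𝓘(ℂ, E) ω M]

/-- The vector field `X` is smooth on `U`. -/
def SmoothFieldOn (U : Set M) (X : Π x : M, RealTangent E x) : Prop :=
  ContMDiffOn 𝓘(ℝ, E) 𝓘(ℝ, E).tangent ∞ (fun x ↦ (⟨x, X x⟩ : TangentBundle 𝓘(ℝ, E) M)) U

/-- `X` is a smooth vector field on `M`. -/
abbrev SmoothField (X : Π x : M, RealTangent E x) : Prop :=
  SmoothFieldOn (E := E) Set.univ X

/-- The curvature
`R(X, Y) Z = ∇_X ∇_Y Z - ∇_Y ∇_X Z - ∇_{[X, Y]} Z` of a connection vanishes. -/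
def IsFlat (nabla : Connection E M) : Prop :=
  ∀ X Y Z : Π x : M, RealTangent E x, SmoothField X → SmoothField Y → SmoothField Z → ∀ x : M,
    nabla (fun y ↦ nabla Z y (Y y)) x (X x) - nabla (fun y ↦ nabla Z y (X y)) x (Y x)
      - nabla Z x (VectorField.mlieBracket 𝓘(ℝ, E) X Y x) = 0

/-- The exterior covariant derivative of a one-form `θ` with values in the tangent bundle,
`(d_∇ θ)(X, Y) = ∇_X (θ Y) - ∇_Y (θ X) - θ [X, Y]`. -/
def extCovDeriv (nabla : Connection E M) (θ : Π x : M, RealTangent E x →L[ℝ] RealTangent E x)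
    (X Y : Π x : M, RealTangent E x) (x : M) : RealTangent E x :=
  nabla (fun y ↦ θ y (Y y)) x (X x) - nabla (fun y ↦ θ y (X y)) x (Y x)
    - θ x (VectorField.mlieBracket 𝓘(ℝ, E) X Y x)

/-- `(M, I, ∇)` is a special complex manifold: the (smooth) linear connection `∇` is flat and
torsion free, and `d_∇ I = 0`. -/
structure IsSpecialComplex (nabla : Connection E M) : Prop where
  smooth : CovariantDerivative.ContMDiffCovariantDerivative nabla ∞
  flat : IsFlat nabla
  torsion_free :
    haveI : FiniteDimensional ℝ E := FiniteDimensional.complexToReal E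
    haveI : CompleteSpace E := FiniteDimensional.complete ℝ E
    nabla.torsion = 0
  dI : ∀ X Y : Π x : M, RealTangent E x, SmoothField X → SmoothField Y → ∀ x : M,
    extCovDeriv nabla (cplx E) X Y x = 0

/-- The covariant derivative of the tensor field `b` of bilinear forms vanishes:
`v (b(Y, Z)) = b(∇_v Y, Z) + b(Y, ∇_v Z)`. -/
def IsParallel (nabla : Connection E M)
    (b : Π x : M, RealTangent E x →L[ℝ] RealTangent E x →L[ℝ] ℝ) : Prop :=
  ∀ Y Z : Π x : M, RealTangent E x, SmoothField Y → SmoothField Z →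
    ∀ (x : M) (v : RealTangent E x),
      mvfderiv 𝓘(ℝ, E) (fun y ↦ b y (Y y) (Z y)) x v
        = b x (nabla Y x v) (Z x) + b x (Y x) (nabla Z x v)

/-- The exterior derivative of a 2-form `w`, evaluated on vector fields. -/
def extDerivTwo (w : Π x : M, RealTangent E x →L[ℝ] RealTangent E x →L[ℝ] ℝ)
    (X Y Z : Π x : M, RealTangent E x) (x : M) : ℝ :=
  mvfderiv 𝓘(ℝ, E) (fun y ↦ w y (Y y) (Z y)) x (X x)
    - mvfderiv 𝓘(ℝ, E) (fun y ↦ w y (X y) (Z y)) x (Y x)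
    + mvfderiv 𝓘(ℝ, E) (fun y ↦ w y (X y) (Y y)) x (Z x)
    - w x (VectorField.mlieBracket 𝓘(ℝ, E) X Y x) (Z x)
    + w x (VectorField.mlieBracket 𝓘(ℝ, E) X Z x) (Y x)
    - w x (VectorField.mlieBracket 𝓘(ℝ, E) Y Z x) (X x)

/-- `w` is a (pseudo-)Kähler form on the complex manifold `M`: a smooth closed nondegenerate
2-form which is `I`-invariant. The metric `w(·, I ·)` may be indefinite. -/
structure IsKahler (w : Π x : M, RealTangent E x →L[ℝ] RealTangent E x →L[ℝ] ℝ) : Prop where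
  smooth : ContMDiff 𝓘(ℝ, E) (𝓘(ℝ, E).prod 𝓘(ℝ, E →L[ℝ] E →L[ℝ] ℝ)) ∞
    (fun x ↦ Bundle.TotalSpace.mk' (E →L[ℝ] E →L[ℝ] ℝ)
      (E := fun x : M ↦ RealTangent E x →L[ℝ] RealTangent E x →L[ℝ] ℝ) x (w x))
  alternating : ∀ (x : M) (u : RealTangent E x), w x u u = 0
  invariant : ∀ (x : M) (u v : RealTangent E x), w x (cplx E x u) (cplx E x v) = w x u v
  nondegenerate : ∀ (x : M) (u : RealTangent E x), (∀ v, w x u v = 0) → u = 0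
  closed : ∀ X Y Z : Π x : M, RealTangent E x, SmoothField X → SmoothField Y → SmoothField Z →
    ∀ x : M, extDerivTwo w X Y Z x = 0

/-- `(M, I, ∇, w)` is a special Kähler manifold. -/
structure IsSpecialKahler (nabla : Connection E M)
    (w : Π x : M, RealTangent E x →L[ℝ] RealTangent E x →L[ℝ] ℝ) : Prop where
  kahler : IsKahler w
  special : IsSpecialComplex nabla
  parallel : IsParallel nabla w

/-- The (pseudo-)Riemannian metric `g(u, v) = w(u, I v)` of a Kähler form. -/
def kahlerMetric (w : Π x : M, RealTangent E x →L[ℝ] RealTangent E x →L[ℝ] ℝ) (x : M) :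
    RealTangent E x →L[ℝ] RealTangent E x →L[ℝ] ℝ :=
  (ContinuousLinearMap.precomp ℝ (cplx E x)).comp (w x)

/-- `D` is the Levi-Civita connection of the (pseudo-)Riemannian metric `g`:
the torsion free connection with `D g = 0`. -/
structure IsLeviCivita (g : Π x : M, RealTangent E x →L[ℝ] RealTangent E x →L[ℝ] ℝ)
    (D : Connection E M) : Prop where
  smooth : CovariantDerivative.ContMDiffCovariantDerivative D ∞
  torsion_free :
    haveI : FiniteDimensional ℝ E := FiniteDimensional.complexToReal E
    haveI : CompleteSpace E := FiniteDimensional.complete ℝ E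
    D.torsion = 0
  metric : IsParallel D g

end Real

section Complexified

/-- The complexified tangent space at `x`. -/
abbrev CTangent (E : Type*) [NormedAddCommGroup E] [NormedSpace ℂ E]
    {M : Type*} [TopologicalSpace M] [ChartedSpace E M] (x : M) : Type _ :=
  ℂ ⊗[ℝ] RealTangent E x

/-- Complex conjugation on the complexified tangent space. -/
def conjC (E : Type*) [NormedAddCommGroup E] [NormedSpace ℂ E]
    {M : Type*} [TopologicalSpace M] [ChartedSpace E M] (x : M) :
    CTangent E x →ₗ[ℝ] CTangent E x :=
  TensorProduct.map Complex.conjAe.toLinearMap LinearMap.id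

/-- The complex-linear extension of the complex structure `I`. -/
def cplxC (E : Type*) [NormedAddCommGroup E] [NormedSpace ℂ E]
    {M : Type*} [TopologicalSpace M] [ChartedSpace E M] (x : M) :
    CTangent E x →ₗ[ℂ] CTangent E x :=
  (cplx E x).toLinearMap.baseChange ℂ

/-- The fibre of `T^{1,0}`: the `i`-eigenspace of `I`. -/
def T10 (E : Type*) [NormedAddCommGroup E] [NormedSpace ℂ E]
    {M : Type*} [TopologicalSpace M] [ChartedSpace E M] (x : M) : Submodule ℂ (CTangent E x) :=
  Module.End.eigenspace (cplxC E x) Complex.I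

/-- The fibre of `T^{0,1}`: the `-i`-eigenspace of `I`. -/
def T01 (E : Type*) [NormedAddCommGroup E] [NormedSpace ℂ E]
    {M : Type*} [TopologicalSpace M] [ChartedSpace E M] (x : M) : Submodule ℂ (CTangent E x) :=
  Module.End.eigenspace (cplxC E x) (-Complex.I)

/-- The projection `(1 - i I) / 2` onto `T^{1,0}` along `T^{0,1}`. -/
def proj10 (E : Type*) [NormedAddCommGroup E] [NormedSpace ℂ E]
    {M : Type*} [TopologicalSpace M] [ChartedSpace E M] (x : M) :
    CTangent E x →ₗ[ℂ] CTangent E x :=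
  (1 / 2 : ℂ) • (LinearMap.id - Complex.I • cplxC E x)

/-- The projection `(1 + i I) / 2` onto `T^{0,1}` along `T^{1,0}`. -/
def proj01 (E : Type*) [NormedAddCommGroup E] [NormedSpace ℂ E]
    {M : Type*} [TopologicalSpace M] [ChartedSpace E M] (x : M) :
    CTangent E x →ₗ[ℂ] CTangent E x :=
  (1 / 2 : ℂ) • (LinearMap.id + Complex.I • cplxC E x)

/-- (Not necessarily smooth) complex one-forms with values in the endomorphisms of the complexified
tangent bundle; `B x ξ` is the endomorphism in the direction `ξ`. -/
abbrev EndForm (E : Type*) [NormedAddCommGroup E] [NormedSpace ℂ E]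
    (M : Type*) [TopologicalSpace M] [ChartedSpace E M] :=
  Π x : M, CTangent E x →ₗ[ℂ] CTangent E x →ₗ[ℂ] CTangent E x

variable {E : Type*} [NormedAddCommGroup E] [NormedSpace ℂ E] [FiniteDimensional ℂ E]
  {M : Type*} [TopologicalSpace M] [ChartedSpace E M] [IsManifold 𝓘(ℂ, E) ω M]

/-- The complex vector field `Z` is smooth on `U`: its real and imaginary parts are. -/
def SmoothCFieldOn (U : Set M) (Z : Π x : M, CTangent E x) : Prop :=
  ∃ X Y : Π x : M, RealTangent E x, SmoothFieldOn U X ∧ SmoothFieldOn U Y ∧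
    ∀ x ∈ U, Z x = (1 : ℂ) ⊗ₜ[ℝ] X x + Complex.I ⊗ₜ[ℝ] Y x

/-- `B` is smooth: it maps smooth complex vector fields on open sets to smooth ones. -/
def IsSmoothEndForm (B : EndForm E M) : Prop :=
  ∀ (U : Set M), IsOpen U → ∀ Z W : Π x : M, CTangent E x,
    SmoothCFieldOn U Z → SmoothCFieldOn U W → SmoothCFieldOn U (fun x ↦ B x (Z x) (W x))

/-- `B ∈ Ω^{1,0}(Hom(T^{1,0}, T^{0,1}))`: `B` is smooth, it vanishes on directions in `T^{0,1}`,
and its values lie in `Hom(T^{1,0}, T^{0,1})`, the endomorphisms of `T^{1,0} ⊕ T^{0,1}` that vanish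
on `T^{0,1}` and map `T^{1,0}` to `T^{0,1}`. -/
structure MemOmega10 (B : EndForm E M) : Prop where
  smooth : IsSmoothEndForm B
  type10 : ∀ (x : M), ∀ ξ ∈ T01 E x, B x ξ = 0
  vanish : ∀ (x : M) (ξ : CTangent E x), ∀ η ∈ T01 E x, B x ξ η = 0
  mapsTo : ∀ (x : M) (ξ : CTangent E x), ∀ η ∈ T10 E x, B x ξ η ∈ T01 E x

/-- `B ∈ Ω^{0,1}(Hom(T^{0,1}, T^{1,0}))`: `B` is smooth, it vanishes on directions in `T^{1,0}`,
and its values lie in `Hom(T^{0,1}, T^{1,0})`, the endomorphisms of `T^{1,0} ⊕ T^{0,1}` that vanish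
on `T^{1,0}` and map `T^{0,1}` to `T^{1,0}`. -/
structure MemOmega01 (B : EndForm E M) : Prop where
  smooth : IsSmoothEndForm B
  type01 : ∀ (x : M), ∀ ξ ∈ T10 E x, B x ξ = 0
  vanish : ∀ (x : M) (ξ : CTangent E x), ∀ η ∈ T10 E x, B x ξ η = 0
  mapsTo : ∀ (x : M) (ξ : CTangent E x), ∀ η ∈ T01 E x, B x ξ η ∈ T10 E x

/-- The real one-form `∇ - D` with values in the endomorphisms of the tangent bundle:
`realDiff nabla D x v u = ∇_v Y - D_v Y` at `x` for any vector field `Y` that is differentiable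
at `x` with `Y x = u`. -/
def realDiff (nabla D : Connection E M) (x : M) :
    RealTangent E x →ₗ[ℝ] RealTangent E x →ₗ[ℝ] RealTangent E x :=
  haveI : FiniteDimensional ℝ E := FiniteDimensional.complexToReal E
  LinearMap.mk₂ ℝ (fun v u ↦ nabla.difference D x u v)
    (fun v v' u ↦ (nabla.difference D x u).map_add v v')
    (fun c v u ↦ (nabla.difference D x u).map_smul c v)
    (fun v u u' ↦ by simp) (fun c v u ↦ by simp)

/-- The complex-linear extension of `∇ - D` to the complexified tangent bundle, as a complex
one-form with values in its endomorphisms. -/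
def diffC (nabla D : Connection E M) : EndForm E M :=
  fun x ↦ LinearMap.BilinMap.baseChange ℂ (realDiff nabla D x)

/-- `A`, the `(1,0)`-part of the one-form `∇ - D`. -/
def formA (nabla D : Connection E M) : EndForm E M :=
  fun x ↦ (diffC nabla D x).comp (proj10 E x)

/-- `Ā`, the `(0,1)`-part of the one-form `∇ - D`. -/
def formAbar (nabla D : Connection E M) : EndForm E M :=
  fun x ↦ (diffC nabla D x).comp (proj01 E x)

end Complexified

end SpecialKahler

end

namespace SpecialKahler

open Filter Set
open scoped Topology

/-! Put S = ∇ - D and T = ∇I. Both are symmetric: S because both connections are torsion free, T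
because d_∇ I is the antisymmetrization of ∇I when ∇ is torsion free. Differentiating I² = -1 shows
that T_v anticommutes with I. Computing v(g(Y, Z)) once from ∇ω = 0 and once from Dg = 0 gives ω(S_v
Y, I Z) + ω(Y, I S_v Z) + ω(Y, T_v Z) = 0, and a Koszul-type permutation argument
(`symm_form_anticommute`) solves this to S = I T / 2. Hence S_v anticommutes with I, and by symmetry
of S so does its dependence on v (`IsSpecialKahler.realDiff_cplx`). After complexification the first
fact makes S exchange the two eigenbundles of I; the two together kill S_ξ η for ξ and η of opposite
types. The rest is that the projections to T^{1,0} and T^{0,1} are smooth and interchanged by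
conjugation. -/

/-- Pointwise algebra behind `∇ - D = I ∘ ∇I / 2`: here `S = ∇ - D` and `T = ∇I`. -/
theorem symm_form_anticommute {V : Type*} [AddCommGroup V] [Module ℝ V]
    (w : V →ₗ[ℝ] V →ₗ[ℝ] ℝ) (J : V →ₗ[ℝ] V) (S T : V → V → V)
    (hJ : ∀ u, J (J u) = -u) (alt : ∀ u, w u u = 0) (inv : ∀ u v, w (J u) (J v) = w u v)
    (nondeg : ∀ u, (∀ v, w u v = 0) → u = 0) (hS : ∀ u v, S u v = S v u)
    (hT : ∀ u v, T u v = T v u) (hTJ : ∀ v u, T v (J u) = -J (T v u))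
    (hST : ∀ v y z, w (S v y) (J z) + w y (J (S v z)) + w y (T v z) = 0) :
    (∀ v u, S v (J u) = -J (S v u)) ∧ ∀ v u, S (J v) u = -J (S v u) := by
  have skew (u v : V) : w u v = -w v u := by
    have h := alt (u + v)
    simp only [map_add, LinearMap.add_apply, alt] at h
    linarith
  -- With g(a, b) = w(a, J b), this reads g(S_v y, z) + g(S_v z, y) = -w(y, T_v z). The left side is
  -- symmetric in y and z, so w(y, T_v z) is totally symmetric.
  have h1 (v y z : V) : w (S v y) (J z) + w (S v z) (J y) + w y (T v z) = 0 := by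
    rw [← hST v y z, ← inv y (J (S v z)), hJ, map_neg, ← skew]
  have half (v y : V) : S v y = (1 / 2 : ℝ) • J (T v y) := by
    rw [← sub_eq_zero]
    refine nondeg _ fun z ↦ ?_
    -- The test vector is replaced by J z, so that the pairing with S becomes g.
    have hz : z = J (-J z) := by rw [map_neg, hJ, neg_neg]
    rw [hz]
    generalize -J z = z
    rw [map_sub, LinearMap.sub_apply, map_smul, LinearMap.smul_apply, inv, skew (T v y) z,
      smul_eq_mul]
    -- All six permutations, combined as in the Koszul formula: symmetry of S isolates g(S_v y, z).
    have e1 := h1 v y z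
    have e1' := h1 v z y
    have e2 := h1 y v z
    have e2' := h1 y z v
    have e3 := h1 z v y
    have e3' := h1 z y v
    rw [hS y v] at e2 e2'
    rw [hS z v, hS z y] at e3 e3'
    rw [hT z v] at e3'
    rw [hT z y] at e3
    rw [hT y v] at e2'
    linarith
  have first (v u : V) : S v (J u) = -J (S v u) := by
    rw [half, half, hTJ, map_neg, map_smul, smul_neg]
  exact ⟨first, fun v u ↦ by rw [hS, first, hS]⟩

/-! ### Smooth real vector fields and the real tensor ∇ - D -/

section Real

variable {E : Type*} [NormedAddCommGroup E] [NormedSpace ℂ E]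
  {M : Type*} [TopologicalSpace M] [ChartedSpace E M]

theorem cplx_cplx (x : M) (u : RealTangent E x) : cplx E x (cplx E x u) = -u := by
  have h (e : E) : Complex.I • Complex.I • e = -e := by
    rw [smul_smul, Complex.I_mul_I, neg_one_smul]
  exact h u

variable [IsManifold 𝓘(ℂ, E) ω M]

/-- The coordinate changes of the real tangent bundle of a complex manifold are complex linear. -/
theorem tangentCoordChange_I_smul {x y z : M}
    (h : z ∈ (extChartAt 𝓘(ℝ, E) x).source ∩ (extChartAt 𝓘(ℝ, E) y).source) (v : E) :
    tangentCoordChange 𝓘(ℝ, E) x y z (Complex.I • v)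
      = Complex.I • tangentCoordChange 𝓘(ℝ, E) x y z v := by
  have : IsManifold 𝓘(ℂ, E) 1 M := IsManifold.of_le (n := ω) le_top
  have h1 := hasFDerivWithinAt_tangentCoordChange (I := 𝓘(ℝ, E)) h
  have h2 := hasFDerivWithinAt_tangentCoordChange (I := 𝓘(ℂ, E)) (x := x) (y := y) (z := z)
    (by simpa using h)
  rw [modelWithCornersSelf_coe, range_id, hasFDerivWithinAt_univ] at h1 h2
  -- Both coordinate changes are derivatives of the same transition map, so the real one is the
  -- restriction of scalars of the complex one.
  have h3 := h1.unique (h2.restrictScalars ℝ)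
  rw [h3]
  exact map_smul (tangentCoordChange 𝓘(ℂ, E) x y z) Complex.I v

theorem SmoothFieldOn.cplx {U : Set M} {X : Π x : M, RealTangent E x}
    (hX : SmoothFieldOn U X) : SmoothFieldOn U (fun x ↦ SpecialKahler.cplx E x (X x)) := by
  intro x₀ hx₀
  have h := hX x₀ hx₀
  rw [Bundle.contMDiffWithinAt_section] at h ⊢
  have h' := ((Complex.I • ContinuousLinearMap.id ℝ E : E →L[ℝ] E).contMDiff
    (n := ∞)).contMDiffAt.comp_contMDiffWithinAt x₀ h
  -- I at x is defined in the preferred chart at x, whereas smoothness near x₀ is tested in the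
  -- chart at x₀; complex linearity of the coordinate change makes I multiplication by i there too.
  have key (x : M) (hx : x ∈ (extChartAt 𝓘(ℝ, E) x₀).source) :
      (trivializationAt E (TangentSpace 𝓘(ℝ, E)) x₀ ⟨x, SpecialKahler.cplx E x (X x)⟩).2
        = Complex.I • (trivializationAt E (TangentSpace 𝓘(ℝ, E)) x₀ ⟨x, X x⟩).2 :=
    tangentCoordChange_I_smul (x := x) (y := x₀) (z := x) ⟨mem_extChartAt_source x, hx⟩ (X x)
  refine h'.congr_of_eventuallyEq ?_ (key x₀ (mem_extChartAt_source x₀))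
  filter_upwards [mem_nhdsWithin_of_mem_nhds (extChartAt_source_mem_nhds (I := 𝓘(ℝ, E)) x₀)] with x hx
  exact key x hx

theorem SmoothFieldOn.mdifferentiableAt {U : Set M} (hU : IsOpen U) {X : Π x : M, RealTangent E x}
    (hX : SmoothFieldOn U X) {x : M} (hx : x ∈ U) :
    MDifferentiableAt 𝓘(ℝ, E) 𝓘(ℝ, E).tangent
      (fun x ↦ (⟨x, X x⟩ : TangentBundle 𝓘(ℝ, E) M)) x :=
  (hX.contMDiffAt (hU.mem_nhds hx)).mdifferentiableAt (by simp)

theorem SmoothField.connection_apply {nabla : Connection E M}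
    (h : CovariantDerivative.ContMDiffCovariantDerivative nabla ∞)
    {X Y : Π x : M, RealTangent E x} (hX : SmoothField X) (hY : SmoothField Y) :
    SmoothField (fun x ↦ nabla Y x (X x)) :=
  ContMDiffOn.clm_bundle_apply (h.contMDiff.contMDiff hY) hX

variable [FiniteDimensional ℂ E]

/-- A vector field that is smooth near a point agrees near this point with a globally smooth
one. -/
theorem SmoothFieldOn.exists_smoothField [T2Space M] {U : Set M} {x₀ : M} (hU : U ∈ 𝓝 x₀)
    {X : Π x : M, RealTangent E x} (hX : SmoothFieldOn U X) :
    ∃ X' : Π x : M, RealTangent E x, SmoothField X' ∧ ∀ᶠ x in 𝓝 x₀, X' x = X x := by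
  have : FiniteDimensional ℝ E := FiniteDimensional.complexToReal E
  obtain ⟨V, hVU, hV, hxV⟩ := mem_nhds_iff.1 hU
  obtain ⟨f, -, hf⟩ := (SmoothBumpFunction.nhds_basis_tsupport (I := 𝓘(ℝ, E)) x₀).mem_iff.1
    (hV.mem_nhds hxV)
  refine ⟨(f : M → ℝ) • X, ?_, ?_⟩
  · exact (ContMDiffOn.smul_section_of_tsupport f.contMDiff.contMDiffOn hV hf
      (ContMDiffOn.mono hX hVU)).contMDiffOn
  · filter_upwards [f.eventuallyEq_one] with x hx
    simp [hx]

theorem exists_smoothField_eq [T2Space M] (x : M) (u : RealTangent E x) :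
    ∃ X : Π x : M, RealTangent E x, SmoothField X ∧ X x = u := by
  obtain ⟨s, hs, h⟩ := FiberBundle.exists_contMDiffOn_extend (k := ∞) 𝓘(ℝ, E) E u
  obtain ⟨X, hX, hXu⟩ := SmoothFieldOn.exists_smoothField hs h
  exact ⟨X, hX, by simpa using hXu.self_of_nhds⟩

theorem realDiff_apply (nabla D : Connection E M) {x : M} (v : RealTangent E x)
    {Y : Π x : M, RealTangent E x}
    (hY : MDifferentiableAt 𝓘(ℝ, E) 𝓘(ℝ, E).tangent
      (fun x ↦ (⟨x, Y x⟩ : TangentBundle 𝓘(ℝ, E) M)) x) :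
    realDiff nabla D x v (Y x) = nabla Y x v - D Y x v := by
  have : FiniteDimensional ℝ E := FiniteDimensional.complexToReal E
  have h := IsCovariantDerivativeOn.difference_apply nabla.isCovariantDerivativeOnUniv
    D.isCovariantDerivativeOnUniv (x := x) (mem_univ x) hY
  exact congr($h v)

/-- Since ∇ - D is tensorial, the fields may be replaced near each point by globally smooth ones, to
which the smoothness of both connections applies. -/
theorem SmoothFieldOn.realDiff [T2Space M] {nabla D : Connection E M}
    (hn : CovariantDerivative.ContMDiffCovariantDerivative nabla ∞)
    (hD : CovariantDerivative.ContMDiffCovariantDerivative D ∞)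
    {U : Set M} (hU : IsOpen U) {X Y : Π x : M, RealTangent E x}
    (hX : SmoothFieldOn U X) (hY : SmoothFieldOn U Y) :
    SmoothFieldOn U (fun x ↦ SpecialKahler.realDiff nabla D x (X x) (Y x)) := by
  intro x₀ hx₀
  obtain ⟨X', hX', hXX'⟩ := hX.exists_smoothField (hU.mem_nhds hx₀)
  obtain ⟨Y', hY', hYY'⟩ := hY.exists_smoothField (hU.mem_nhds hx₀)
  have h := ContMDiffOn.sub_section (SmoothField.connection_apply hn hX' hY')
    (SmoothField.connection_apply hD hX' hY')
  refine ((h.contMDiffAt univ_mem).congr_of_eventuallyEq ?_).contMDiffWithinAt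
  filter_upwards [hXX', hYY'] with x hx hy
  rw [← hx, ← hy, realDiff_apply nabla D _ (hY'.mdifferentiableAt isOpen_univ (mem_univ x))]
  rfl

/-! ### Symmetry of ∇I and of ∇ - D -/

/-- Replacing [X, Y] by ∇_X Y - ∇_Y X turns d_∇ I = 0 into this symmetry of ∇I. -/
theorem IsSpecialComplex.covDeriv_cplx_symm {nabla : Connection E M} (h : IsSpecialComplex nabla)
    {X Y : Π x : M, RealTangent E x} (hX : SmoothField X) (hY : SmoothField Y) (x : M) :
    nabla (fun y ↦ cplx E y (Y y)) x (X x) - cplx E x (nabla Y x (X x))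
      = nabla (fun y ↦ cplx E y (X y)) x (Y x) - cplx E x (nabla X x (Y x)) := by
  have : FiniteDimensional ℝ E := FiniteDimensional.complexToReal E
  have : CompleteSpace E := FiniteDimensional.complete ℝ E
  have h1 := h.dI X Y hX hY x
  have h2 := nabla.torsion_eq_zero_iff.1 h.torsion_free
    (hX.mdifferentiableAt isOpen_univ (mem_univ x)) (hY.mdifferentiableAt isOpen_univ (mem_univ x))
  rw [extCovDeriv, ← h2, map_sub] at h1
  rw [← sub_eq_zero, ← h1]
  abel

/-- ∇ and D have the same antisymmetrization, namely the Lie bracket. -/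
theorem realDiff_symm {nabla D : Connection E M} [T2Space M]
    (hn : haveI : FiniteDimensional ℝ E := FiniteDimensional.complexToReal E
      haveI : CompleteSpace E := FiniteDimensional.complete ℝ E
      nabla.torsion = 0)
    (hD : haveI : FiniteDimensional ℝ E := FiniteDimensional.complexToReal E
      haveI : CompleteSpace E := FiniteDimensional.complete ℝ E
      D.torsion = 0)
    (x : M) (u v : RealTangent E x) : realDiff nabla D x u v = realDiff nabla D x v u := by
  have : FiniteDimensional ℝ E := FiniteDimensional.complexToReal E
  have : CompleteSpace E := FiniteDimensional.complete ℝ E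
  obtain ⟨X, hX, rfl⟩ := exists_smoothField_eq x u
  obtain ⟨Y, hY, rfl⟩ := exists_smoothField_eq x v
  have hX' := hX.mdifferentiableAt isOpen_univ (mem_univ x)
  have hY' := hY.mdifferentiableAt isOpen_univ (mem_univ x)
  have h1 := nabla.torsion_eq_zero_iff.1 hn hX' hY'
  have h2 := D.torsion_eq_zero_iff.1 hD hX' hY'
  rw [realDiff_apply _ _ _ hX', realDiff_apply _ _ _ hY', sub_eq_sub_iff_sub_eq_sub, h1, h2]

/-- `∇ - D` anticommutes with `I`, both in its values and in the direction. -/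
theorem IsSpecialKahler.realDiff_cplx [T2Space M] {nabla D : Connection E M}
    {w : Π x : M, RealTangent E x →L[ℝ] RealTangent E x →L[ℝ] ℝ}
    (hM : IsSpecialKahler nabla w) (hD : IsLeviCivita (kahlerMetric w) D) (x : M) :
    (∀ v u : RealTangent E x,
      realDiff nabla D x v (cplx E x u) = -cplx E x (realDiff nabla D x v u)) ∧
    ∀ v u : RealTangent E x,
      realDiff nabla D x (cplx E x v) u = -cplx E x (realDiff nabla D x v u) := by
  choose ext hext hextx using exists_smoothField_eq (E := E) x
  have hsymm {X Y : Π x : M, RealTangent E x} (hX : SmoothField X) (hY : SmoothField Y) :=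
    hM.special.covDeriv_cplx_symm hX hY
  let T (v u : RealTangent E x) : RealTangent E x :=
    nabla (fun y ↦ cplx E y (ext u y)) x v - cplx E x (nabla (ext u) x v)
  -- Tensoriality of ∇I follows from its symmetry: after the swap, Y enters only as a direction,
  -- that is, through its value at x.
  have hT (v : RealTangent E x) {Y : Π x : M, RealTangent E x} (hY : SmoothField Y) :
      nabla (fun y ↦ cplx E y (Y y)) x v - cplx E x (nabla Y x v) = T v (Y x) := by
    have h1 := hsymm (hext v) hY x
    have h2 := hsymm (hext v) (hext (Y x)) x
    rw [hextx] at h1 h2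
    rw [hextx] at h2
    rw [h1, ← h2]
  refine symm_form_anticommute
    ((ContinuousLinearMap.coeLM ℝ).comp (w x).toLinearMap) (cplx E x).toLinearMap
    (fun v u ↦ realDiff nabla D x v u) T (cplx_cplx x) (hM.kahler.alternating x)
    (hM.kahler.invariant x) (hM.kahler.nondegenerate x)
    (realDiff_symm hM.special.torsion_free hD.torsion_free x) (fun u v ↦ ?_) (fun v u ↦ ?_)
    fun v y z ↦ ?_
  · have h := hsymm (hext u) (hext v) x
    rwa [hextx, hextx] at h
  · have h := hT v (hext u).cplx
    rw [hextx] at h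
    refine h.symm.trans ?_
    -- Differentiating I(I u) = -u is what makes T_v anticommute with I.
    have h2 : (fun y ↦ cplx E y (cplx E y (ext u y))) = (-1 : ℝ) • ext u := by
      funext y
      simp [cplx_cplx]
    have h3 := nabla.isCovariantDerivativeOnUniv.smul_const (-1 : ℝ)
      ((hext u).mdifferentiableAt isOpen_univ (mem_univ x)) (mem_univ x)
    rw [h2, h3]
    change _ = -cplx E x (nabla (fun y ↦ cplx E y (ext u y)) x v - cplx E x (nabla (ext u) x v))
    rw [map_sub, cplx_cplx]
    simp only [smul_apply]
    module
  · obtain ⟨Y, hY, rfl⟩ := exists_smoothField_eq x y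
    obtain ⟨Z, hZ, rfl⟩ := exists_smoothField_eq x z
    -- The pair (Y, I Z) for ω and the pair (Y, Z) for g give two expressions for the same
    -- derivative v(g(Y, Z)).
    have h1 := hM.parallel Y _ hY hZ.cplx x v
    have h2 := hD.metric Y Z hY hZ x v
    have h3 := hT v hZ
    rw [sub_eq_iff_eq_add] at h3
    simp only [realDiff_apply _ _ _ (hY.mdifferentiableAt isOpen_univ (mem_univ x)),
      realDiff_apply _ _ _ (hZ.mdifferentiableAt isOpen_univ (mem_univ x))]
    rw [h3] at h1
    change _ = w x (D Y x v) (cplx E x (Z x)) + w x (Y x) (cplx E x (D Z x v)) at h2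
    change mvfderiv 𝓘(ℝ, E) (fun y ↦ w y (Y y) (cplx E y (Z y))) x v = _ at h2
    have h4 := h1.symm.trans h2
    change w x (nabla Y x v - D Y x v) (cplx E x (Z x))
      + w x (Y x) (cplx E x (nabla Z x v - D Z x v)) + w x (Y x) (T v (Z x)) = 0
    simp only [map_sub, map_add, sub_apply] at h4 ⊢
    linarith

end Real

section Complexified

/-! ### Linear algebra of the complexified tangent space -/

section Fibre

variable {E : Type*} [NormedAddCommGroup E] [NormedSpace ℂ E]
  {M : Type*} [TopologicalSpace M] [ChartedSpace E M] {x : M}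

theorem cplxC_cplxC (ξ : CTangent E x) : cplxC E x (cplxC E x ξ) = -ξ := by
  induction ξ using TensorProduct.induction_on with
  | zero => simp
  | add ξ ζ h h' => rw [map_add, map_add, h, h', neg_add]
  | tmul a u =>
    change a ⊗ₜ[ℝ] cplx E x (cplx E x u) = _
    rw [cplx_cplx, TensorProduct.tmul_neg]

theorem conjC_tmul (a : ℂ) (u : RealTangent E x) :
    conjC E x (a ⊗ₜ[ℝ] u) = (starRingEnd ℂ a) ⊗ₜ[ℝ] u := rfl

theorem conjC_smul (c : ℂ) (ξ : CTangent E x) :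
    conjC E x (c • ξ) = (starRingEnd ℂ c) • conjC E x ξ := by
  induction ξ using TensorProduct.induction_on with
  | zero => simp
  | add ξ ζ h h' => rw [smul_add, map_add, h, h', map_add, smul_add]
  | tmul a u =>
    rw [TensorProduct.smul_tmul', conjC_tmul, conjC_tmul, TensorProduct.smul_tmul', smul_eq_mul,
      smul_eq_mul, map_mul]

theorem conjC_cplxC (ξ : CTangent E x) : conjC E x (cplxC E x ξ) = cplxC E x (conjC E x ξ) := by
  induction ξ using TensorProduct.induction_on with
  | zero => simp
  | add ξ ζ h h' => simp only [map_add, h, h']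
  | tmul a u => rfl

/-- I is real, so conjugation only changes the sign of the coefficient i in the projection. -/
theorem conjC_proj10 (ξ : CTangent E x) : conjC E x (proj10 E x ξ) = proj01 E x (conjC E x ξ) := by
  simp [proj10, proj01, conjC_smul, conjC_cplxC, map_ofNat]

theorem proj10_add_proj01 (ξ : CTangent E x) : proj10 E x ξ + proj01 E x ξ = ξ := by
  simp only [proj10, proj01, LinearMap.smul_apply, LinearMap.sub_apply, LinearMap.add_apply,
    LinearMap.id_apply]
  module

theorem mem_T10 {ξ : CTangent E x} : ξ ∈ T10 E x ↔ cplxC E x ξ = Complex.I • ξ :=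
  Module.End.mem_eigenspace_iff

theorem mem_T01 {ξ : CTangent E x} : ξ ∈ T01 E x ↔ cplxC E x ξ = -Complex.I • ξ :=
  Module.End.mem_eigenspace_iff

theorem proj10_mem (ξ : CTangent E x) : proj10 E x ξ ∈ T10 E x := by
  simp only [mem_T10, proj10, LinearMap.smul_apply, LinearMap.sub_apply, LinearMap.id_apply,
    map_smul, map_sub, cplxC_cplxC]
  match_scalars <;> ring_nf <;> simp [neg_div]

theorem proj01_mem (ξ : CTangent E x) : proj01 E x ξ ∈ T01 E x := by
  simp only [mem_T01, proj01, LinearMap.smul_apply, LinearMap.add_apply, LinearMap.id_apply,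
    map_smul, map_add, cplxC_cplxC]
  match_scalars <;> ring_nf <;> simp [neg_div]

theorem proj10_eq_zero {ξ : CTangent E x} (h : ξ ∈ T01 E x) : proj10 E x ξ = 0 := by
  simp [proj10, mem_T01.1 h, smul_smul]

theorem proj01_eq_zero {ξ : CTangent E x} (h : ξ ∈ T10 E x) : proj01 E x ξ = 0 := by
  rw [proj01, LinearMap.smul_apply, LinearMap.add_apply, LinearMap.smul_apply, mem_T10.1 h,
    smul_smul, Complex.I_mul_I, LinearMap.id_apply, neg_one_smul, add_neg_cancel, smul_zero]

/-- Displays the real and imaginary parts, which is the form in which smoothness of complex fields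
is defined. -/
theorem proj10_apply_mk (u v : RealTangent E x) :
    proj10 E x ((1 : ℂ) ⊗ₜ[ℝ] u + Complex.I ⊗ₜ[ℝ] v)
      = (1 : ℂ) ⊗ₜ[ℝ] ((1 / 2 : ℝ) • (u + cplx E x v))
        + Complex.I ⊗ₜ[ℝ] ((1 / 2 : ℝ) • (v - cplx E x u)) := by
  have h (a : ℂ) (u : RealTangent E x) : cplxC E x (a ⊗ₜ[ℝ] u) = a ⊗ₜ[ℝ] cplx E x u := rfl
  have e (a : ℂ) (u : RealTangent E x) : a ⊗ₜ[ℝ] u = a • ((1 : ℂ) ⊗ₜ[ℝ] u) := by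
    rw [TensorProduct.smul_tmul', smul_eq_mul, mul_one]
  simp only [proj10, LinearMap.smul_apply, LinearMap.sub_apply, LinearMap.id_apply, map_add, h,
    TensorProduct.tmul_smul, TensorProduct.tmul_add, TensorProduct.tmul_sub]
  simp only [e Complex.I, smul_smul]
  match_scalars <;> simp

theorem proj01_apply_mk (u v : RealTangent E x) :
    proj01 E x ((1 : ℂ) ⊗ₜ[ℝ] u + Complex.I ⊗ₜ[ℝ] v)
      = (1 : ℂ) ⊗ₜ[ℝ] ((1 / 2 : ℝ) • (u - cplx E x v))
        + Complex.I ⊗ₜ[ℝ] ((1 / 2 : ℝ) • (v + cplx E x u)) := by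
  have h (a : ℂ) (u : RealTangent E x) : cplxC E x (a ⊗ₜ[ℝ] u) = a ⊗ₜ[ℝ] cplx E x u := rfl
  have e (a : ℂ) (u : RealTangent E x) : a ⊗ₜ[ℝ] u = a • ((1 : ℂ) ⊗ₜ[ℝ] u) := by
    rw [TensorProduct.smul_tmul', smul_eq_mul, mul_one]
  simp only [proj01, LinearMap.smul_apply, LinearMap.add_apply, LinearMap.id_apply, map_add, h,
    TensorProduct.tmul_smul, TensorProduct.tmul_add, TensorProduct.tmul_sub]
  simp only [e Complex.I, smul_smul]
  match_scalars <;> simp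

end Fibre

variable {E : Type*} [NormedAddCommGroup E] [NormedSpace ℂ E]
  {M : Type*} [TopologicalSpace M] [ChartedSpace E M] [IsManifold 𝓘(ℂ, E) ω M]

/-! ### Smoothness, conjugation and anticommutation for the complexified ∇ - D -/

theorem SmoothFieldOn.add {U : Set M} {X Y : Π x : M, RealTangent E x}
    (hX : SmoothFieldOn U X) (hY : SmoothFieldOn U Y) : SmoothFieldOn U (fun x ↦ X x + Y x) :=
  ContMDiffOn.add_section hX hY

theorem SmoothFieldOn.sub {U : Set M} {X Y : Π x : M, RealTangent E x}
    (hX : SmoothFieldOn U X) (hY : SmoothFieldOn U Y) : SmoothFieldOn U (fun x ↦ X x - Y x) :=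
  ContMDiffOn.sub_section hX hY

theorem SmoothFieldOn.const_smul {U : Set M} (c : ℝ) {X : Π x : M, RealTangent E x}
    (hX : SmoothFieldOn U X) : SmoothFieldOn U (fun x ↦ c • X x) :=
  ContMDiffOn.const_smul_section hX

theorem SmoothCFieldOn.proj10 {U : Set M} {Z : Π x : M, CTangent E x} (hZ : SmoothCFieldOn U Z) :
    SmoothCFieldOn U (fun x ↦ SpecialKahler.proj10 E x (Z x)) := by
  obtain ⟨X, Y, hX, hY, h⟩ := hZ
  exact ⟨_, _, (hX.add hY.cplx).const_smul (1 / 2), (hY.sub hX.cplx).const_smul (1 / 2),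
    fun x hx ↦ by simp only [h x hx, proj10_apply_mk]⟩

theorem SmoothCFieldOn.proj01 {U : Set M} {Z : Π x : M, CTangent E x} (hZ : SmoothCFieldOn U Z) :
    SmoothCFieldOn U (fun x ↦ SpecialKahler.proj01 E x (Z x)) := by
  obtain ⟨X, Y, hX, hY, h⟩ := hZ
  exact ⟨_, _, (hX.sub hY.cplx).const_smul (1 / 2), (hY.add hX.cplx).const_smul (1 / 2),
    fun x hx ↦ by simp only [h x hx, proj01_apply_mk]⟩

variable [FiniteDimensional ℂ E] {nabla D : Connection E M}

theorem diffC_tmul (x : M) (a b : ℂ) (u v : RealTangent E x) :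
    diffC nabla D x (a ⊗ₜ[ℝ] u) (b ⊗ₜ[ℝ] v) = (a * b) ⊗ₜ[ℝ] realDiff nabla D x u v := by
  simp [diffC]

theorem conjC_diffC (x : M) (ξ η : CTangent E x) :
    conjC E x (diffC nabla D x ξ η) = diffC nabla D x (conjC E x ξ) (conjC E x η) := by
  induction ξ using TensorProduct.induction_on with
  | zero => simp
  | add ξ ζ h h' => simp only [map_add, LinearMap.add_apply, h, h']
  | tmul a u =>
    induction η using TensorProduct.induction_on with
    | zero => simp
    | add ξ ζ h h' => simp only [map_add, h, h']
    | tmul b v => rw [diffC_tmul, conjC_tmul, conjC_tmul, conjC_tmul, diffC_tmul, map_mul]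

theorem diffC_apply_cplxC {x : M}
    (h : ∀ v u : RealTangent E x,
      realDiff nabla D x v (cplx E x u) = -cplx E x (realDiff nabla D x v u))
    (ξ η : CTangent E x) :
    diffC nabla D x ξ (cplxC E x η) = -cplxC E x (diffC nabla D x ξ η) := by
  induction ξ using TensorProduct.induction_on with
  | zero => simp
  | add ξ ζ h h' => simp only [map_add, LinearMap.add_apply, h, h', neg_add]
  | tmul a u =>
    induction η using TensorProduct.induction_on with
    | zero => simp
    | add ξ ζ h h' => simp only [map_add, h, h', neg_add]
    | tmul b v =>
      change diffC nabla D x (a ⊗ₜ[ℝ] u) (b ⊗ₜ[ℝ] cplx E x v) = _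
      rw [diffC_tmul, diffC_tmul, h, TensorProduct.tmul_neg]
      rfl

theorem diffC_cplxC_apply {x : M}
    (h : ∀ v u : RealTangent E x,
      realDiff nabla D x (cplx E x v) u = -cplx E x (realDiff nabla D x v u))
    (ξ η : CTangent E x) :
    diffC nabla D x (cplxC E x ξ) η = -cplxC E x (diffC nabla D x ξ η) := by
  induction ξ using TensorProduct.induction_on with
  | zero => simp
  | add ξ ζ h h' => simp only [map_add, LinearMap.add_apply, h, h', neg_add]
  | tmul a u =>
    induction η using TensorProduct.induction_on with
    | zero => simp
    | add ξ ζ h h' => simp only [map_add, h, h', neg_add]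
    | tmul b v =>
      change diffC nabla D x (a ⊗ₜ[ℝ] cplx E x u) (b ⊗ₜ[ℝ] v) = _
      rw [diffC_tmul, diffC_tmul, h, TensorProduct.tmul_neg]
      rfl

theorem isSmoothEndForm_diffC [T2Space M]
    (hn : CovariantDerivative.ContMDiffCovariantDerivative nabla ∞)
    (hD : CovariantDerivative.ContMDiffCovariantDerivative D ∞) :
    IsSmoothEndForm (diffC nabla D) := by
  rintro U hU Z W ⟨X, Y, hX, hY, hZ⟩ ⟨X', Y', hX', hY', hW⟩
  -- Real and imaginary parts of S(X + iY, X' + iY').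
  refine ⟨_, _, (hX.realDiff hn hD hU hX').sub (hY.realDiff hn hD hU hY'),
    (hX.realDiff hn hD hU hY').add (hY.realDiff hn hD hU hX'), fun x hx ↦ ?_⟩
  simp only [hZ x hx, hW x hx, map_add, LinearMap.add_apply, diffC_tmul, mul_one, one_mul,
    Complex.I_mul_I, TensorProduct.neg_tmul, TensorProduct.tmul_add, TensorProduct.tmul_sub]
  abel

theorem diffC_eq_formA_add_formAbar (x : M) :
    diffC nabla D x = formA nabla D x + formAbar nabla D x := by
  refine LinearMap.ext fun ξ ↦ ?_
  change _ = diffC nabla D x (proj10 E x ξ) + diffC nabla D x (proj01 E x ξ)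
  rw [← map_add, proj10_add_proj01]

theorem formAbar_conjC (x : M) (ξ η : CTangent E x) :
    formAbar nabla D x (conjC E x ξ) (conjC E x η) = conjC E x (formA nabla D x ξ η) := by
  change diffC nabla D x (proj01 E x (conjC E x ξ)) _ = conjC E x (diffC nabla D x (proj10 E x ξ) η)
  rw [conjC_diffC, conjC_proj10]

/-! ### The types of A and of its conjugate -/

variable [T2Space M] {w : Π x : M, RealTangent E x →L[ℝ] RealTangent E x →L[ℝ] ℝ}

theorem IsSpecialKahler.memOmega10_formA
    (hM : IsSpecialKahler nabla w) (hD : IsLeviCivita (kahlerMetric w) D) :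
    MemOmega10 (formA nabla D) where
  smooth U hU _ _ hZ hW := isSmoothEndForm_diffC hM.special.smooth hD.smooth U hU _ _ hZ.proj10 hW
  type10 x ξ hξ := by
    change diffC nabla D x (proj10 E x ξ) = 0
    rw [proj10_eq_zero hξ, map_zero]
  vanish x ξ η hη := by
    change diffC nabla D x (proj10 E x ξ) η = 0
    obtain ⟨h1, h2⟩ := hM.realDiff_cplx hD x
    -- I may be moved from the argument to the direction. The direction lies in T^{1,0} and η in
    -- T^{0,1}, so the value is multiplied by i on one side and by -i on the other, hence is zero.
    have h := (diffC_apply_cplxC h1 (proj10 E x ξ) η).trans (diffC_cplxC_apply h2 _ η).symm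
    rw [mem_T10.1 (proj10_mem ξ), mem_T01.1 hη, map_smul, map_smul, LinearMap.smul_apply,
      ← sub_eq_zero, ← sub_smul, smul_eq_zero] at h
    exact h.resolve_left (by simp [sub_eq_zero, neg_eq_iff_add_eq_zero])
  mapsTo x ξ η hη := by
    -- Anticommuting with I reverses the sign of the eigenvalue.
    have h := diffC_apply_cplxC (hM.realDiff_cplx hD x).1 (proj10 E x ξ) η
    rw [mem_T10.1 hη, map_smul] at h
    rw [mem_T01, neg_smul, ← neg_eq_iff_eq_neg]
    exact h.symm

theorem IsSpecialKahler.memOmega01_formAbar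
    (hM : IsSpecialKahler nabla w) (hD : IsLeviCivita (kahlerMetric w) D) :
    MemOmega01 (formAbar nabla D) where
  smooth U hU _ _ hZ hW := isSmoothEndForm_diffC hM.special.smooth hD.smooth U hU _ _ hZ.proj01 hW
  type01 x ξ hξ := by
    change diffC nabla D x (proj01 E x ξ) = 0
    rw [proj01_eq_zero hξ, map_zero]
  vanish x ξ η hη := by
    change diffC nabla D x (proj01 E x ξ) η = 0
    obtain ⟨h1, h2⟩ := hM.realDiff_cplx hD x
    have h := (diffC_apply_cplxC h1 (proj01 E x ξ) η).trans (diffC_cplxC_apply h2 _ η).symm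
    rw [mem_T01.1 (proj01_mem ξ), mem_T10.1 hη, map_smul, map_smul, LinearMap.smul_apply,
      ← sub_eq_zero, ← sub_smul, smul_eq_zero] at h
    exact h.resolve_left (by simp [sub_neg_eq_add])
  mapsTo x ξ η hη := by
    have h := diffC_apply_cplxC (hM.realDiff_cplx hD x).1 (proj01 E x ξ) η
    rw [mem_T01.1 hη, map_smul, neg_smul, neg_inj] at h
    rw [mem_T10]
    exact h.symm

end Complexified

end SpecialKahler

theorem mainTheorem4 {E : Type*} [NormedAddCommGroup E] [NormedSpace ℂ E] [FiniteDimensional ℂ E]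
    {M : Type*} [TopologicalSpace M] [T2Space M] [ChartedSpace E M] [IsManifold 𝓘(ℂ, E) ω M]
    (nabla D : SpecialKahler.Connection E M)
    (w : Π x : M, SpecialKahler.RealTangent E x →L[ℝ] SpecialKahler.RealTangent E x →L[ℝ] ℝ)
    (hM : SpecialKahler.IsSpecialKahler nabla w)
    (hD : SpecialKahler.IsLeviCivita (SpecialKahler.kahlerMetric w) D) :
    (∀ x : M, SpecialKahler.diffC nabla D x
        = SpecialKahler.formA nabla D x + SpecialKahler.formAbar nabla D x) ∧
    (∀ (x : M) (ξ η : SpecialKahler.CTangent E x),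
      SpecialKahler.formAbar nabla D x (SpecialKahler.conjC E x ξ) (SpecialKahler.conjC E x η)
        = SpecialKahler.conjC E x (SpecialKahler.formA nabla D x ξ η)) ∧
    SpecialKahler.MemOmega10 (SpecialKahler.formA nabla D) ∧
    SpecialKahler.MemOmega01 (SpecialKahler.formAbar nabla D) :=
  ⟨SpecialKahler.diffC_eq_formA_add_formAbar, SpecialKahler.formAbar_conjC,
    hM.memOmega10_formA hD, hM.memOmega01_formAbar hD⟩
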